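/- Let $V$ be a finite set. A mixed graph $\mathcal G$ on $V$ has directed edges $a\to b$ and bidirected edges $a\leftrightarrow b$ between distinct vertices. Write $\mathrm{pa}(W)$ for the set of vertices $w$ with $w\to v$ for some $v\in W$, $\mathrm{sib}(v)=\{w: w\leftrightarrow v\}$, and $\mathrm{an}(W)$ for the set of vertices having a directed path (possibly of length $0$) to some vertex of $W$. For $v\in W$ let $\mathrm{dis}_W(v)$ be the set of vertices connected to $v$ by a (possibly trivial) path of bidirected edges within $W$, called a district of the induced subgraph $\mathcal G_W$, and let $\mathrm{dis}_W(U)=\bigcup_{v\in U}\mathrm{dis}_W(v)$ for $U\subseteq W$. A path is a sequence of distinct vertices together with an edge joining each consecutive pair. A nonendpoint of a path is a collider if both edges of the path at it have an arrowhead at it, and a noncollider otherwise. A path is m-connecting given $C$ if no noncollider on it is in $C$ and every collider on it is in $\mathrm{an}(C)$. For disjoint $A,B,C\subseteq V$ with $A,B$ nonempty, $A$ and $B$ are m-separated by $C$ if there is no m-connecting path given $C$ between any $a\in A$ and any $b\in B$. Two graphs on $V$ are Markov equivalent if exactly the same m-separations hold in both. $\mathcal G$ is a maximal ancestral graph (MAG)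 if it has no directed cycle, any two distinct nonadjacent vertices $a,b$ are m-separated by some $C\subseteq V\setminus\{a,b\}$, and $\mathrm{sib}(v)\cap\mathrm{an}(\{v\})=\emptyset$ for every $v$. A nonempty set $H\subseteq V$ is a head of $\mathcal G$ if no element of $H$ is an ancestor of another element of $H$, and $H$ is contained in a single district of $\mathcal G_{\mathrm{an}(H)}$. Its tail is $\mathrm{tail}(H)=(D\setminus H)\cup\mathrm{pa}(D)$, where $D=\mathrm{dis}_{\mathrm{an}(H)}(H)$. Let $\mathcal S(\mathcal G)$ be the collection of all sets $H\cup A$ with $H$ a head and $A\subseteq\mathrm{tail}(H)$. The characteristic imset is $c_{\mathcal G}(S)=1$ if $S\in\mathcal S(\mathcal G)$ or $S=\emptyset$, and $c_{\mathcal G}(S)=0$ otherwise. The standard imset of $\mathcal G$ is the function on subsets of $V$ given by $$u_{\mathcal G}(B)=\sum_{A:\,B\subseteq A\subseteq V}(-1)^{|A\setminus B|}\,\bigl(1-c_{\mathcal G}(A)\bigr).$$ **Corollary.** Let $\mathcal G$ and $\mathcal H$ be two MAGs on the same finite vertex set $V$. Then $\mathcal G$ and $\mathcal H$ are Markov equivalent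 if and only if $u_{\mathcal G}=u_{\mathcal H}$. -/

import Mathlib

/-- A mixed graph on the vertex set `V`, with directed edges `a → b` and bidirected edges `a ↔ b`,
each joining two distinct vertices. -/
structure MixedGraph (V : Type*) where
  /-- `dir a b` means `a → b`. -/
  dir : V → V → Prop
  /-- `bi a b` means `a ↔ b`. -/
  bi : V → V → Prop
  dir_irrefl : ∀ v, ¬ dir v v
  bi_irrefl : ∀ v, ¬ bi v v
  bi_symm : ∀ a b, bi a b → bi b a

namespace MixedGraph

variable {V : Type*} (G : MixedGraph V)

/-- Two vertices are adjacent if some edge joins them. -/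
def Adj (a b : V) : Prop := G.dir a b ∨ G.dir b a ∨ G.bi a b

/-- The parents of a set of vertices. -/
def pa (W : Set V) : Set V := {w | ∃ v ∈ W, G.dir w v}

/-- The siblings of a vertex. -/
def sib (v : V) : Set V := {w | G.bi w v}

/-- The ancestors of a set of vertices (every vertex is its own ancestor). -/
def an (W : Set V) : Set V := {w | ∃ v ∈ W, Relation.ReflTransGen G.dir w v}

/-- The descendants of a vertex (every vertex is its own descendant). -/
def de (v : V) : Set V := {w | Relation.ReflTransGen G.dir v w}

/-- The district of a vertex `v ∈ W` in the induced subgraph on `W`: all vertices joined to `v`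
by a chain of bidirected edges within `W`, and `v` itself. -/
def disIn (W : Set V) (v : V) : Set V :=
  {w | Relation.ReflTransGen (fun x y => x ∈ W ∧ y ∈ W ∧ G.bi x y) w v}

/-- The union of the districts, in the induced subgraph on `W`, of the vertices of `U`. -/
def disInSet (W U : Set V) : Set V := ⋃ v ∈ U, G.disIn W v

/-! ### m-separation -/

/-- How an edge is traversed from `a` to `b`: `a → b`, `a ← b` or `a ↔ b`. -/
inductive EdgeKind where
  | forward
  | backward
  | bidirected

/-- The edge has an arrowhead at the vertex it is traversed to. -/
def EdgeKind.HeadAtTarget : EdgeKind → Prop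
  | .forward => True
  | .backward => False
  | .bidirected => True

/-- The edge has an arrowhead at the vertex it is traversed from. -/
def EdgeKind.HeadAtSource : EdgeKind → Prop
  | .forward => False
  | .backward => True
  | .bidirected => True

/-- The graph has an edge of the given kind from `a` to `b`. -/
def HasEdge : EdgeKind → V → V → Prop
  | .forward, a, b => G.dir a b
  | .backward, a, b => G.dir b a
  | .bidirected, a, b => G.bi a b

/-- Walks in a mixed graph, recording which edge is used at each step. -/
inductive Walk (G : MixedGraph V) : V → V → Type _ where
  | nil (a : V) : Walk G a a
  | cons {a b c : V} (e : EdgeKind) (h : G.HasEdge e a b) (p : Walk G b c) : Walk G a c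

namespace Walk

variable {G}

/-- The vertices of a walk, in order. -/
def support : {a b : V} → G.Walk a b → List V
  | a, _, nil _ => [a]
  | a, _, cons _ _ p => a :: p.support

/-- A walk is a path if its vertices are distinct. -/
def IsPath {a b : V} (p : G.Walk a b) : Prop := p.support.Nodup

/-- The nonendpoints of a walk, each between the edge by which it is entered and the edge by which
it is left. -/
def nonendpoints : {a b : V} → G.Walk a b → List (EdgeKind × V × EdgeKind)
  | _, _, nil _ => []
  | _, _, cons _ _ (nil _) => []
  | _, _, @cons _ _ _ w _ e _ (cons e' h' p) => (e, w, e') :: (cons e' h' p).nonendpoints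

/-- A path is m-connecting given `C` if every collider on it is an ancestor of `C` and no
noncollider on it belongs to `C`. -/
def MConnecting {a b : V} (p : G.Walk a b) (C : Set V) : Prop :=
  p.IsPath ∧ ∀ t ∈ p.nonendpoints,
    ((t.1.HeadAtTarget ∧ t.2.2.HeadAtSource) → t.2.1 ∈ G.an C) ∧
    (¬ (t.1.HeadAtTarget ∧ t.2.2.HeadAtSource) → t.2.1 ∉ C)

end Walk

/-- `A` and `B` are m-separated by `C` (meant for disjoint `A`, `B`, `C` with `A`, `B` nonempty):
no path between `A` and `B` is m-connecting given `C`. -/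
def MSep (A B C : Set V) : Prop :=
  ∀ a ∈ A, ∀ b ∈ B, ∀ p : G.Walk a b, ¬ p.MConnecting C

/-- Two graphs on the same vertices are Markov equivalent if they have the same m-separations. -/
def MarkovEquivalent (G H : MixedGraph V) : Prop :=
  ∀ A B C : Set V, A.Nonempty → B.Nonempty → Disjoint A B → Disjoint A C → Disjoint B C →
    (G.MSep A B C ↔ H.MSep A B C)

/-- Maximal ancestral graphs. -/
structure IsMAG : Prop where
  /-- There is no directed cycle. -/
  acyclic : ∀ v, ¬ Relation.TransGen G.dir v v
  /-- Nonadjacent vertices are m-separated by some set. -/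
  maximal : ∀ a b, a ≠ b → ¬ G.Adj a b → ∃ C : Set V, a ∉ C ∧ b ∉ C ∧ G.MSep {a} {b} C
  /-- No sibling of a vertex is one of its ancestors. -/
  ancestral : ∀ v, G.sib v ∩ G.an {v} = ∅

/-! ### Heads, tails and parametrizing sets -/

/-- The barren subset of `W`: the vertices with no proper descendant in `W`. -/
def barren (W : Set V) : Set V := {w ∈ W | G.de w ∩ W = {w}}

/-- `H` is a head: it is its own barren subset, and it lies in a single district of the induced
subgraph on its ancestors. The empty set is not a head, as the empty graph has no district. -/
def IsHead (H : Set V) : Prop :=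
  G.barren H = H ∧ ∃ v ∈ G.an H, H ⊆ G.disIn (G.an H) v

/-- The tail of a head. -/
def tail (H : Set V) : Set V :=
  (G.disInSet (G.an H) H \ H) ∪ G.pa (G.disInSet (G.an H) H)

/-- The parametrizing sets: unions of a head with a subset of its tail. -/
def parametrizingSets : Set (Set V) :=
  {S | ∃ H A : Set V, G.IsHead H ∧ A ⊆ G.tail H ∧ S = H ∪ A}

/-! ### Imsets -/

open Classical in
/-- The characteristic imset: the indicator function of the parametrizing sets, where the empty
set is counted as a parametrizing set, so that the entries of the standard imset sum to `0`. -/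
noncomputable def characteristicImset (S : Finset V) : ℤ :=
  if S = ∅ ∨ (S : Set V) ∈ G.parametrizingSets then 1 else 0

/-- The standard imset: the Möbius inversion of `1` minus the characteristic imset. -/
noncomputable def standardImset [Fintype V] [DecidableEq V] (B : Finset V) : ℤ :=
  ∑ A : Finset V with B ⊆ A, (-1) ^ (A \ B).card * (1 - G.characteristicImset A)

end MixedGraph

namespace MixedGraph

variable {V : Type*} {G : MixedGraph V}

/-! ### Ancestors, districts and Markov blankets -/

/-! Both conditions are equivalent to equality of the parametrizing sets. For imsets this is Möbius
inversion (`standardImset_eq_iff`, `characteristicImset_eq_iff`).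

For Markov equivalence, a set `W` is parametrizing iff it lies in one blanket (a district and its
parents) inside `an W` (`mem_parametrizingSets_iff`). The augmentation criterion
`mSep_singleton_iff` then describes m-connection of `a`, `b` given `C` by chains from `a` to `b`
outside `C`, with consecutive vertices in a common parametrizing set inside `an ({a, b} ∪ C)`.

Equivalent acyclic graphs have the same parametrizing sets: if `W` is not parametrizing, two of its
elements are separated by a set containing the rest of `W`, which is impossible when `W` is
parametrizing.

Conversely, only the ancestor sets in the criterion depend on more than the parametrizing sets. A
chain is carried from `G` to `H` by choosing the sets of minimal weight
(`exists_parametrizingSet_of_linked`) and the chain without shortcuts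
(`chain_of_parametrizingSets_eq`); both choices force all vertices involved to be ancestors in `H`.
-/

theorem subset_an (W : Set V) : W ⊆ G.an W := fun w hw => ⟨w, hw, .refl⟩

theorem an_mono {W W' : Set V} (h : W ⊆ W') : G.an W ⊆ G.an W' :=
  fun _ ⟨v, hv, hr⟩ => ⟨v, h hv, hr⟩

theorem mem_an_of_reach {W : Set V} {u v : V} (h : Relation.ReflTransGen G.dir u v)
    (hv : v ∈ G.an W) : u ∈ G.an W :=
  let ⟨w, hw, hr⟩ := hv; ⟨w, hw, h.trans hr⟩

theorem mem_an_of_dir {W : Set V} {u v : V} (h : G.dir u v) (hv : v ∈ G.an W) : u ∈ G.an W :=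
  mem_an_of_reach (.single h) hv

theorem an_subset_an {W W' : Set V} (h : W ⊆ G.an W') : G.an W ⊆ G.an W' :=
  fun _ ⟨_, hv, hr⟩ => mem_an_of_reach hr (h hv)

theorem self_mem_disIn (L : Set V) (z : V) : z ∈ G.disIn L z := Relation.ReflTransGen.refl

theorem disIn_mono {L L' : Set V} (h : L ⊆ L') (z : V) : G.disIn L z ⊆ G.disIn L' z :=
  fun _ hw => Relation.ReflTransGen.mono (fun _ _ h' => ⟨h h'.1, h h'.2.1, h'.2.2⟩) _ _ hw

theorem disIn_subset {L : Set V} {z : V} (hz : z ∈ L) : G.disIn L z ⊆ L := by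
  intro w hw
  rcases Relation.ReflTransGen.cases_head hw with rfl | ⟨_, h, _⟩
  exacts [hz, h.1]

theorem disIn_symm {L : Set V} {w z : V} (h : w ∈ G.disIn L z) : z ∈ G.disIn L w := by
  have : Std.Symm fun x y => x ∈ L ∧ y ∈ L ∧ G.bi x y :=
    ⟨fun _ _ h => ⟨h.2.1, h.1, G.bi_symm _ _ h.2.2⟩⟩
  exact Relation.ReflTransGen.stdSymm.symm _ _ h

theorem disIn_eq {L : Set V} {w z : V} (h : w ∈ G.disIn L z) : G.disIn L w = G.disIn L z := by
  ext x
  exact ⟨fun hx => Relation.ReflTransGen.trans hx h,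
    fun hx => Relation.ReflTransGen.trans hx (disIn_symm h)⟩

/-- The district of `z` in the induced subgraph on `L`, together with its parents. -/
def blanket (G : MixedGraph V) (L : Set V) (z : V) : Set V :=
  G.disIn L z ∪ G.pa (G.disIn L z)

theorem self_mem_blanket (L : Set V) (z : V) : z ∈ G.blanket L z := Or.inl (self_mem_disIn L z)

theorem blanket_eq {L : Set V} {w z : V} (h : w ∈ G.disIn L z) :
    G.blanket L w = G.blanket L z := by
  rw [blanket, blanket, disIn_eq h]

theorem blanket_mono {L L' : Set V} (h : L ⊆ L') (z : V) : G.blanket L z ⊆ G.blanket L' z :=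
  Set.union_subset_union (disIn_mono h z) fun _ ⟨v, hv, hd⟩ => ⟨v, disIn_mono h z hv, hd⟩

theorem blanket_subset {W : Set V} {z : V} (hz : z ∈ G.an W) :
    G.blanket (G.an W) z ⊆ G.an W := by
  rintro x (hx | ⟨v, hv, hd⟩)
  · exact disIn_subset hz hx
  · exact mem_an_of_dir hd (disIn_subset hz hv)

theorem mem_blanket_of_dir {L : Set V} {u v : V} (h : G.dir u v) : u ∈ G.blanket L v :=
  Or.inr ⟨v, self_mem_disIn L v, h⟩

theorem mem_disIn_of_bi {L : Set V} {u v : V} (hu : u ∈ L) (hv : v ∈ L) (h : G.bi u v) :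
    u ∈ G.disIn L v := Relation.ReflTransGen.single ⟨hu, hv, h⟩

/-! ### Parametrizing sets -/

section Acyclic

variable (hac : ∀ v, ¬ Relation.TransGen G.dir v v)
include hac

theorem mem_barren {W : Set V} {w : V} :
    w ∈ G.barren W ↔ w ∈ W ∧ ∀ v ∈ W, ¬ Relation.TransGen G.dir w v := by
  constructor
  · rintro ⟨hw, h⟩
    refine ⟨hw, fun v hv ht => ?_⟩
    have : v ∈ G.de w ∩ W := ⟨ht.to_reflTransGen, hv⟩
    rw [h] at this
    rw [Set.mem_singleton_iff.1 this] at ht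
    exact hac w ht
  · rintro ⟨hw, h⟩
    refine ⟨hw, Set.Subset.antisymm ?_ ?_⟩
    · rintro v ⟨hv, hvW⟩
      rcases Relation.reflTransGen_iff_eq_or_transGen.1 hv with e | ht
      · exact e
      · exact absurd ht (h v hvW)
    · rintro _ rfl
      exact ⟨Relation.ReflTransGen.refl, hw⟩

theorem barren_eq_self_iff {W : Set V} :
    G.barren W = W ↔ ∀ w ∈ W, ∀ v ∈ W, ¬ Relation.TransGen G.dir w v := by
  constructor
  · intro h w hw
    rw [← h] at hw
    exact ((mem_barren hac).1 hw).2
  · intro h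
    ext w
    rw [mem_barren hac]
    exact ⟨fun h => h.1, fun hw => ⟨hw, h w hw⟩⟩

theorem wellFounded_descendants [Finite V] :
    WellFounded fun x y : V => Relation.TransGen G.dir y x := by
  have : IsTrans V fun x y => Relation.TransGen G.dir y x := ⟨fun _ _ _ h h' => h'.trans h⟩
  have : Std.Irrefl fun x y : V => Relation.TransGen G.dir y x := ⟨hac⟩
  exact Finite.wellFounded_of_trans_of_irrefl _

theorem subset_an_barren [Finite V] (W : Set V) : W ⊆ G.an (G.barren W) := by
  intro w
  induction w using (wellFounded_descendants hac).induction with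
  | _ w ih =>
    intro hw
    by_cases hb : w ∈ G.barren W
    · exact subset_an _ hb
    · rw [mem_barren hac] at hb
      push Not at hb
      obtain ⟨v, hv, ht⟩ := hb hw
      exact mem_an_of_reach ht.to_reflTransGen (ih v ht hv)

theorem an_barren [Finite V] (W : Set V) : G.an (G.barren W) = G.an W :=
  Set.Subset.antisymm (an_mono fun _ h => h.1) (an_subset_an (subset_an_barren hac W))

/-- A vertex that is a parent of the district has a proper descendant in `W`, so a barren vertex can
only be in the district itself. -/
theorem mem_disIn_of_mem_barren {W : Set V} {w z : V} (hw : w ∈ G.barren W) (hz : z ∈ G.an W)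
    (h : w ∈ G.blanket (G.an W) z) : w ∈ G.disIn (G.an W) z := by
  rcases h with h | ⟨v, hv, hd⟩
  · exact h
  · obtain ⟨x, hx, hr⟩ := disIn_subset hz hv
    exact absurd (Relation.TransGen.head' hd hr) (((mem_barren hac).1 hw).2 x hx)

/-- A set is parametrizing iff it lies in one blanket of the subgraph on its ancestors. -/
theorem mem_parametrizingSets_iff [Finite V] {W : Set V} :
    W ∈ G.parametrizingSets ↔ ∃ z ∈ G.an W, W ⊆ G.blanket (G.an W) z := by
  have key : ∀ {H : Set V} {v : V}, H.Nonempty → H ⊆ G.disIn (G.an H) v →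
      G.disInSet (G.an H) H = G.disIn (G.an H) v := by
    rintro H v ⟨h, hh⟩ hH
    refine Set.Subset.antisymm (Set.iUnion₂_subset fun u hu => (disIn_eq (hH hu)).le) ?_
    rw [← disIn_eq (hH hh)]
    exact Set.subset_biUnion_of_mem hh
  constructor
  · rintro ⟨H, A, ⟨hb, v, hv, hH⟩, hA, rfl⟩
    have hne : H.Nonempty := let ⟨h, hh, _⟩ := hv; ⟨h, hh⟩
    rw [tail, key hne hH] at hA
    have hsub : H ∪ A ⊆ G.blanket (G.an H) v :=
      Set.union_subset (fun x hx => Or.inl (hH hx)) fun x hx =>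
        (hA hx).imp (fun h => h.1) id
    exact ⟨v, an_mono Set.subset_union_left hv,
      hsub.trans (blanket_mono (an_mono Set.subset_union_left) v)⟩
  -- The head is the barren subset of `W`; it has the same ancestors as `W`, hence the same district
  -- and blanket.
  · rintro ⟨z, hz, hW⟩
    have hB : G.barren W ⊆ G.disIn (G.an (G.barren W)) z := fun w hw => by
      rw [an_barren hac]
      exact mem_disIn_of_mem_barren hac hw hz (hW hw.1)
    have hz' : z ∈ G.an (G.barren W) := by rwa [an_barren hac]
    have hne : (G.barren W).Nonempty := let ⟨h, hh, _⟩ := hz'; ⟨h, hh⟩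
    refine ⟨G.barren W, W \ G.barren W, ⟨?_, z, hz', hB⟩, ?_, ?_⟩
    · rw [barren_eq_self_iff hac]
      exact fun w hw v hv => ((mem_barren hac).1 hw).2 v hv.1
    · rw [tail, key hne hB, an_barren hac]
      exact fun w hw => (hW hw.1).imp (fun h => ⟨h, hw.2⟩) id
    · exact (Set.union_sdiff_cancel fun _ h => h.1).symm

/-- In a parametrizing set `W`, a vertex without proper descendants in `W` lies in the district
whose blanket contains `W`. -/
theorem exists_transGen_or_subset_blanket [Finite V] {W : Set V} (hW : W ∈ G.parametrizingSets)
    {x : V} (hx : x ∈ W) :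
    (∃ w ∈ W, Relation.TransGen G.dir x w) ∨ W ⊆ G.blanket (G.an W) x := by
  obtain ⟨z, hz, hsub⟩ := (mem_parametrizingSets_iff hac).1 hW
  by_cases h : x ∈ G.barren W
  · right
    rwa [blanket_eq (mem_disIn_of_mem_barren hac h hz (hsub hx))]
  · left
    rw [mem_barren hac] at h
    push Not at h
    exact h hx

theorem mem_parametrizingSets_of_subset_blanket [Finite V] {W : Set V} {x : V} (hx : x ∈ W)
    (h : W ⊆ G.blanket (G.an W) x) : W ∈ G.parametrizingSets :=
  (mem_parametrizingSets_iff hac).2 ⟨x, subset_an W hx, h⟩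

/-- Deleting a vertex with a proper descendant in `W` leaves `an W` unchanged, so the same blanket
still works. -/
theorem diff_singleton_mem_parametrizingSets [Finite V] {W : Set V}
    (hW : W ∈ G.parametrizingSets) {d w : V} (hw : w ∈ W) (h : Relation.TransGen G.dir d w) :
    W \ {d} ∈ G.parametrizingSets := by
  have hwd : w ≠ d := by
    rintro rfl
    exact hac w h
  have hsub : W ⊆ G.an (W \ {d}) := by
    intro x hx
    by_cases hxd : x = d
    · subst hxd
      exact mem_an_of_reach h.to_reflTransGen (subset_an _ ⟨hw, hwd⟩)
    · exact subset_an _ ⟨hx, hxd⟩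
  have : G.an (W \ {d}) = G.an W :=
    Set.Subset.antisymm (an_mono Set.sdiff_subset) (an_subset_an hsub)
  rw [mem_parametrizingSets_iff hac] at hW ⊢
  rw [this]
  obtain ⟨z, hz, h⟩ := hW
  exact ⟨z, hz, Set.sdiff_subset.trans h⟩

theorem insert_mem_parametrizingSets [Finite V] {W : Set V} {d e : V} (hd : d ∈ W)
    (hW : W ⊆ G.blanket (G.an W) d) (h : G.dir e d ∨ G.bi e d) :
    insert e W ∈ G.parametrizingSets := by
  refine mem_parametrizingSets_of_subset_blanket hac (Set.mem_insert_of_mem _ hd) ?_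
  refine Set.insert_subset ?_ (hW.trans (blanket_mono (an_mono (Set.subset_insert _ _)) _))
  rcases h with h | h
  · exact mem_blanket_of_dir h
  · exact Or.inl (mem_disIn_of_bi (subset_an _ (Set.mem_insert _ _))
      (subset_an _ (Set.mem_insert_of_mem _ hd)) h)

theorem union_mem_parametrizingSets [Finite V] {W W' : Set V} {x : V} (hx : x ∈ W)
    (hW : W ⊆ G.blanket (G.an W) x) (hW' : W' ⊆ G.blanket (G.an W') x) :
    W ∪ W' ∈ G.parametrizingSets :=
  mem_parametrizingSets_of_subset_blanket hac (Or.inl hx)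
    (Set.union_subset (hW.trans (blanket_mono (an_mono Set.subset_union_left) _))
      (hW'.trans (blanket_mono (an_mono Set.subset_union_right) _)))

/-- The witness is the whole blanket of `z`: bidirected chains ending at `z` never leave the
district, so they survive in the ancestors of the blanket. -/
theorem exists_parametrizingSet_iff [Finite V] {W : Set V} {x y : V} :
    (∃ S ∈ G.parametrizingSets, x ∈ S ∧ y ∈ S ∧ S ⊆ G.an W) ↔
      ∃ z ∈ G.an W, x ∈ G.blanket (G.an W) z ∧ y ∈ G.blanket (G.an W) z := by
  constructor
  · rintro ⟨S, hS, hx, hy, hSW⟩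
    obtain ⟨z, hz, hsub⟩ := (mem_parametrizingSets_iff hac).1 hS
    have := hsub.trans (blanket_mono (an_subset_an hSW) z)
    exact ⟨z, an_subset_an hSW hz, this hx, this hy⟩
  · rintro ⟨z, hz, hx, hy⟩
    refine ⟨_, ?_, hx, hy, blanket_subset hz⟩
    refine mem_parametrizingSets_of_subset_blanket hac (self_mem_blanket _ z) ?_
    have hsub : G.disIn (G.an W) z ⊆ G.disIn (G.an (G.blanket (G.an W) z)) z := by
      intro w hw
      induction hw using Relation.ReflTransGen.head_induction_on with
      | refl => exact self_mem_disIn _ _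
      | head h' h ih =>
        exact Relation.ReflTransGen.head
          ⟨subset_an _ (Or.inl (Relation.ReflTransGen.head h' h)), subset_an _ (Or.inl h),
            h'.2.2⟩ ih
    exact Set.union_subset_union hsub fun _ ⟨v, hv, hd⟩ => ⟨v, hsub hv, hd⟩

theorem pair_mem_parametrizingSets [Finite V] {d e : V} (h : G.Adj d e) :
    {d, e} ∈ G.parametrizingSets := by
  have one : ∀ {d e : V}, G.dir d e ∨ G.bi d e → {d, e} ∈ G.parametrizingSets := fun {d e} h =>
    insert_mem_parametrizingSets hac (Set.mem_singleton e)
      (Set.singleton_subset_iff.2 (self_mem_blanket _ e)) h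
  rcases h with h | h | h
  · exact one (.inl h)
  · rw [Set.pair_comm]
    exact one (.inl h)
  · exact one (.inr h)

end Acyclic

/-! ### Walks and m-connection -/

/-- A triple consisting of a nonendpoint and the two edges at it does not block a walk given `C`. -/
def Unblocked (G : MixedGraph V) (C : Set V) (t : EdgeKind × V × EdgeKind) : Prop :=
  ((t.1.HeadAtTarget ∧ t.2.2.HeadAtSource) → t.2.1 ∈ G.an C) ∧
    (¬ (t.1.HeadAtTarget ∧ t.2.2.HeadAtSource) → t.2.1 ∉ C)

namespace Walk

/-- No nonendpoint blocks the walk given `C`. -/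
def Open (C : Set V) {a b : V} (p : G.Walk a b) : Prop :=
  ∀ t ∈ p.nonendpoints, G.Unblocked C t

/-- The first vertex of the walk, entered by an edge of kind `e`, does not block. -/
def OpenAfter (C : Set V) (e : EdgeKind) : {a b : V} → G.Walk a b → Prop
  | _, _, nil _ => True
  | a, _, cons e' _ _ => G.Unblocked C (e, a, e')

variable {C : Set V}

theorem open_nil (a : V) : (nil a : G.Walk a a).Open C := fun _ ht => by
  simp [nonendpoints] at ht

theorem open_cons {a b c : V} {e : EdgeKind} {h : G.HasEdge e a b} {p : G.Walk b c} :
    (cons e h p).Open C ↔ p.OpenAfter C e ∧ p.Open C := by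
  cases p with
  | nil => simp [Open, nonendpoints, OpenAfter]
  | cons e' h' p => simp [Open, nonendpoints, OpenAfter]

theorem openAfter_congr {a b : V} {p : G.Walk a b} {e e' : EdgeKind}
    (h : e.HeadAtTarget ↔ e'.HeadAtTarget) : p.OpenAfter C e ↔ p.OpenAfter C e' := by
  cases p with
  | nil => rfl
  | cons => simp [OpenAfter, Unblocked, h]

theorem openAfter_of_notMem {a b : V} {p : G.Walk a b} {e : EdgeKind}
    (he : ¬ e.HeadAtTarget) (h : a ∉ C) : p.OpenAfter C e := by
  cases p with
  | nil => trivial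
  | cons => exact ⟨fun h' => absurd h'.1 he, fun _ => h⟩

theorem openAfter_of_mem_an {a b : V} {p : G.Walk a b} (e : EdgeKind) (h : a ∈ G.an C)
    (h' : a ∉ C) : p.OpenAfter C e := by
  cases p with
  | nil => trivial
  | cons => exact ⟨fun _ => h, fun _ => h'⟩

/-- On an open walk, a vertex entered through an arrowhead is an ancestor of the last vertex or
of `C`. -/
theorem mem_an_of_openAfter {a b : V} (p : G.Walk a b) {e : EdgeKind} (he : e.HeadAtTarget)
    (h : p.OpenAfter C e) (hp : p.Open C) : a ∈ G.an (insert b C) := by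
  induction p generalizing e with
  | nil a => exact subset_an _ (Set.mem_insert _ _)
  | cons e' h' q ih =>
    rw [open_cons] at hp
    cases e' with
    | forward => exact mem_an_of_dir h' (ih (e := .forward) trivial hp.1 hp.2)
    | backward => exact an_mono (Set.subset_insert _ _) (h.1 ⟨he, trivial⟩)
    | bidirected => exact an_mono (Set.subset_insert _ _) (h.1 ⟨he, trivial⟩)

/-- Used to cut out a loop at `v`. The last clause keeps the fact that `v` did not block for some
entering edge, which is what is known about `v` before the rest `t`. -/
theorem exists_split {a b : V} (p : G.Walk a b) {v : V} (hv : v ∈ p.support) (hp : p.Open C) :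
    ∃ (s : G.Walk a v) (t : G.Walk v b), s.Open C ∧ t.Open C ∧
      (∀ e, p.OpenAfter C e → s.OpenAfter C e) ∧ List.Sublist t.support p.support ∧
      ∀ e, p.OpenAfter C e → ∃ f, t.OpenAfter C f := by
  induction p with
  | nil a =>
    obtain rfl : v = a := by simpa [support] using hv
    exact ⟨nil v, nil v, hp, hp, fun _ h => h, .refl _, fun e h => ⟨e, h⟩⟩
  | @cons a c b e h q ih =>
    by_cases hva : v = a
    · subst hva
      exact ⟨nil v, cons e h q, open_nil v, hp, fun _ _ => trivial, .refl _, fun e h => ⟨e, h⟩⟩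
    · rw [open_cons] at hp
      have hv' : v ∈ q.support := by simpa [support, hva] using hv
      obtain ⟨s, t, hs, ht, hst, hsub, hf⟩ := ih hv' hp.2
      exact ⟨cons e h s, t, open_cons.2 ⟨hst e hp.1, hs⟩, ht, fun _ h => h, hsub.cons _,
        fun _ _ => hf e hp.1⟩

/-- An open walk can be shortened to an open path. -/
theorem exists_isPath (hac : ∀ v, ¬ Relation.TransGen G.dir v v) {a b : V} (p : G.Walk a b)
    (hp : p.Open C) :
    ∃ q : G.Walk a b, q.IsPath ∧ q.Open C ∧ ∀ e, p.OpenAfter C e → q.OpenAfter C e := by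
  classical
  induction p with
  | nil a => exact ⟨nil a, by simp [IsPath, support], hp, fun _ h => h⟩
  | @cons a c b e₁ h p ih =>
    rw [open_cons] at hp
    obtain ⟨q, hq, hqo, hqe⟩ := ih hp.2
    by_cases ha : a ∈ q.support
    · obtain ⟨s, t, hs, ht, hse, hsub, hf⟩ := exists_split q ha hqo
      obtain ⟨f, hf⟩ := hf _ (hqe _ hp.1)
      refine ⟨t, hsub.nodup hq, ht, fun e he => ?_⟩
      cases t with
      | nil => trivial
      | cons e' h' t =>
        change G.Unblocked C (f, a, e') at hf
        change G.Unblocked C (e, a, e₁) at he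
        change G.Unblocked C (e, a, e')
        by_cases hhead : e.HeadAtTarget
        swap
        · exact ⟨fun h' => absurd h'.1 hhead, fun _ => he.2 fun h' => hhead h'.1⟩
        by_cases hs₁ : e₁.HeadAtSource
        · exact ⟨fun _ => he.1 ⟨hhead, hs₁⟩, fun h' => hf.2 fun h'' => h' ⟨hhead, h''.2⟩⟩
        · refine ⟨fun _ => ?_, fun _ => he.2 fun h' => hs₁ h'.2⟩
          cases e₁ with
          | backward => exact absurd trivial hs₁
          | bidirected => exact absurd trivial hs₁
          | forward =>
            -- The only new collider: the removed loop leaves `a` by a directed edge to a vertex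
            -- that is an ancestor of `a` or of `C`. Acyclicity excludes the former.
            obtain ⟨v, hv, hr⟩ := mem_an_of_openAfter s (e := .forward) trivial
              (hse _ (hqe _ hp.1)) hs
            rcases hv with rfl | hv
            · exact absurd (Relation.TransGen.head' h hr) (hac _)
            · exact ⟨v, hv, hr.head h⟩
    · exact ⟨cons e₁ h q, List.nodup_cons.2 ⟨ha, hq⟩, open_cons.2 ⟨hqe _ hp.1, hqo⟩,
        fun _ h => h⟩

end Walk

/-- Two vertices outside `C` that lie in a common blanket of the subgraph on `an W`. -/
def Linked (G : MixedGraph V) (W C : Set V) (x y : V) : Prop :=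
  x ∉ C ∧ y ∉ C ∧ ∃ z ∈ G.an W, x ∈ G.blanket (G.an W) z ∧ y ∈ G.blanket (G.an W) z

/-! ### Open walks and chains of linked vertices -/

section Chain

variable {C : Set V} {a b : V}

open Relation (ReflTransGen)

theorem Linked.of_mem_blanket {W : Set V} {x y : V} (hx : x ∉ C) (hy : y ∉ C) (hyW : y ∈ G.an W)
    (h : x ∈ G.blanket (G.an W) y) : G.Linked W C x y :=
  ⟨hx, hy, y, hyW, h, self_mem_blanket _ _⟩

/-- The induction behind `chain_of_open`: the walk `p` is entered by an edge of kind `e`, and `a` is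
linked to its first vertex, or to a vertex in the blanket of its first vertex. -/
theorem chain_of_open_aux {w : V} (p : G.Walk w b) (hb : b ∉ C) (e : EdgeKind)
    (he : p.OpenAfter C e) (hp : p.Open C) (hw : w ∈ G.an (insert a (insert b C)))
    (hhead : e.HeadAtTarget → ∃ x, ReflTransGen (G.Linked (insert a (insert b C)) C) a x ∧
      x ∉ C ∧ x ∈ G.blanket (G.an (insert a (insert b C))) w)
    (htail : ¬ e.HeadAtTarget → ReflTransGen (G.Linked (insert a (insert b C)) C) a w) :
    ReflTransGen (G.Linked (insert a (insert b C)) C) a b := by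
  induction p generalizing e with
  | nil b =>
    by_cases h : e.HeadAtTarget
    · obtain ⟨x, hr, hxC, hx⟩ := hhead h
      exact hr.tail (.of_mem_blanket hxC hb hw hx)
    · exact htail h
  | @cons w v b e' h p ih =>
    rw [Walk.open_cons] at hp
    change G.Unblocked C (e, w, e') at he
    have hv : v ∈ G.an (insert a (insert b C)) := by
      cases e' with
      | forward =>
        exact an_mono (Set.subset_insert _ _)
          (Walk.mem_an_of_openAfter p (e := .forward) trivial hp.1 hp.2)
      | bidirected =>
        exact an_mono (Set.subset_insert _ _)
          (Walk.mem_an_of_openAfter p (e := .bidirected) trivial hp.1 hp.2)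
      | backward => exact mem_an_of_dir h hw
    refine ih hb e' hp.1 hp.2 hv ?_ ?_
    all_goals intro he'
    · by_cases hcol : e.HeadAtTarget ∧ e'.HeadAtSource
      · obtain ⟨x, hr, hxC, hx⟩ := hhead hcol.1
        refine ⟨x, hr, hxC, ?_⟩
        cases e' with
        | forward => exact hcol.2.elim
        | backward => exact he'.elim
        | bidirected => rwa [← blanket_eq (mem_disIn_of_bi hw hv h)]
      · have hwC := he.2 hcol
        refine ⟨w, ?_, hwC, ?_⟩
        · by_cases hh : e.HeadAtTarget
          · obtain ⟨x, hr, hxC, hx⟩ := hhead hh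
            exact hr.tail (.of_mem_blanket hxC hwC hw hx)
          · exact htail hh
        · cases e' with
          | forward => exact mem_blanket_of_dir h
          | backward => exact he'.elim
          | bidirected => exact Or.inl (mem_disIn_of_bi hw hv h)
    · cases e' with
      | forward => exact absurd trivial he'
      | bidirected => exact absurd trivial he'
      | backward =>
        have hvw : v ∈ G.blanket (G.an (insert a (insert b C))) w := mem_blanket_of_dir h
        have hvC : v ∉ C := by
          cases p with
          | nil => exact hb
          | cons e'' _ _ => exact hp.1.2 fun h' => h'.1.elim
        by_cases hh : e.HeadAtTarget
        · obtain ⟨x, hr, hxC, hx⟩ := hhead hh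
          exact hr.tail ⟨hxC, hvC, w, hw, hx, hvw⟩
        · exact (htail hh).tail ⟨he.2 fun h' => hh h'.1, hvC, w, hw, self_mem_blanket _ _, hvw⟩

theorem chain_of_open (p : G.Walk a b) (ha : a ∉ C) (hb : b ∉ C) (hp : p.Open C) :
    ReflTransGen (G.Linked (insert a (insert b C)) C) a b :=
  chain_of_open_aux p hb .backward (Walk.openAfter_of_notMem id ha) hp
    (subset_an _ (Set.mem_insert _ _)) (fun h => h.elim) fun _ => .refl

/-- A directed path starting outside `an C` avoids `C` and has no colliders, even when its start is
entered through an arrowhead. -/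
theorem exists_open_of_reach {w : V} (h : ReflTransGen G.dir w b) (hw : w ∉ G.an C) :
    ∃ p : G.Walk w b, p.Open C ∧ p.OpenAfter C .forward := by
  induction h using ReflTransGen.head_induction_on with
  | refl => exact ⟨.nil b, Walk.open_nil b, trivial⟩
  | @head w v h h' ih =>
    have hv : v ∉ G.an C := fun h'' => hw (mem_an_of_dir h h'')
    obtain ⟨p, hp, hpe⟩ := ih hv
    exact ⟨.cons .forward h p, Walk.open_cons.2 ⟨hpe, hp⟩,
      fun h => h.2.elim, fun _ h => hw (subset_an _ h)⟩

theorem exists_open_of_reach_start {w : V} (h : ReflTransGen G.dir w a) (hw : w ∉ G.an C)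
    (p : G.Walk w b) (hp : p.Open C) : ∃ q : G.Walk a b, q.Open C := by
  induction h using ReflTransGen.head_induction_on with
  | refl => exact ⟨p, hp⟩
  | @head w v h h' ih =>
    have hv : v ∉ G.an C := fun h'' => hw (mem_an_of_dir h h'')
    exact ih hv (.cons .backward h p) (Walk.open_cons.2
      ⟨Walk.openAfter_of_notMem id fun h => hw (subset_an _ h), hp⟩)

/-- An open walk from an ancestor of `{a, b} ∪ C` can be entered through an arrowhead, up to a
change of walk, unless there is an open walk from `a` to `b`. -/
theorem exists_openAfter_forward {w : V} (hw : w ∈ G.an (insert a (insert b C))) (p : G.Walk w b)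
    (hp : p.Open C) (h : w ∉ C ∨ ∃ v e h, ∃ q : G.Walk v b, p = .cons e h q ∧ e.HeadAtSource) :
    (∃ q : G.Walk a b, q.Open C) ∨ ∃ q : G.Walk w b, q.Open C ∧ q.OpenAfter C .forward := by
  by_cases hC : w ∈ G.an C
  · right
    refine ⟨p, hp, ?_⟩
    by_cases hwC : w ∈ C
    · obtain ⟨v, e, h, q, rfl, hs⟩ := h.resolve_left (not_not.2 hwC)
      exact ⟨fun _ => hC, fun h' => absurd ⟨trivial, hs⟩ h'⟩
    · exact Walk.openAfter_of_mem_an _ hC hwC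
  · obtain ⟨x, hx, hr⟩ := hw
    rcases hx with rfl | rfl | hx
    · exact .inl (exists_open_of_reach_start hr hC p hp)
    · exact .inr (exists_open_of_reach hr hC)
    · exact absurd ⟨x, hx, hr⟩ hC

/-- The walk from `y` is extended backwards along the district of `z` to `x`. A district vertex in
`an C` may be a collider; any other one has a directed path, avoiding `C`, to `a` or `b`, which
either yields an open walk from `a` or replaces the rest of the walk. -/
theorem exists_open_of_linked {x y : V} (h : G.Linked (insert a (insert b C)) C x y)
    (hy : ∃ p : G.Walk y b, p.Open C) :
    (∃ q : G.Walk a b, q.Open C) ∨ ∃ q : G.Walk x b, q.Open C := by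
  obtain ⟨hxC, hyC, z, hz, hx, hyz⟩ := h
  obtain ⟨p, hp⟩ := hy
  rw [or_iff_not_imp_left]
  intro hne
  have enter : ∀ {w : V}, w ∈ G.an (insert a (insert b C)) → ∀ p : G.Walk w b, p.Open C →
      (w ∉ C ∨ ∃ v e h, ∃ q : G.Walk v b, p = .cons e h q ∧ e.HeadAtSource) →
      ∃ q : G.Walk w b, q.Open C ∧ q.OpenAfter C .forward := fun hw p hp h =>
    (exists_openAfter_forward hw p hp h).resolve_left hne
  have hzw : ∃ w ∈ G.disIn (G.an (insert a (insert b C))) z,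
      ∃ q : G.Walk w b, q.Open C ∧ q.OpenAfter C .forward := by
    rcases hyz with h | ⟨v, hv, hd⟩
    · exact ⟨y, h, enter (disIn_subset hz h) p hp (.inl hyC)⟩
    · exact ⟨v, hv, enter (disIn_subset hz hv) (.cons .backward hd p)
        (Walk.open_cons.2 ⟨Walk.openAfter_of_notMem id hyC, hp⟩)
        (.inr ⟨_, _, _, _, rfl, trivial⟩)⟩
  have hall : ∀ w ∈ G.disIn (G.an (insert a (insert b C))) z,
      ∃ q : G.Walk w b, q.Open C ∧ q.OpenAfter C .forward := by
    obtain ⟨w, hw, hq⟩ := hzw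
    rw [← disIn_eq hw]
    intro v hv
    induction hv using ReflTransGen.head_induction_on with
    | refl => exact hq
    | @head u v h _ ih =>
      obtain ⟨q, hqo, hqe⟩ := ih
      exact enter h.1 (.cons .bidirected h.2.2 q)
        (Walk.open_cons.2 ⟨(Walk.openAfter_congr Iff.rfl).1 hqe, hqo⟩)
        (.inr ⟨_, _, _, _, rfl, trivial⟩)
  rcases hx with h | ⟨v, hv, hd⟩
  · obtain ⟨q, hq, _⟩ := hall x h
    exact ⟨q, hq⟩
  · obtain ⟨q, hqo, hqe⟩ := hall v hv
    exact ⟨.cons .forward hd q, Walk.open_cons.2 ⟨hqe, hqo⟩⟩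

theorem exists_open_of_chain (h : ReflTransGen (G.Linked (insert a (insert b C)) C) a b) :
    ∃ p : G.Walk a b, p.Open C := by
  have key : ∀ {x}, ReflTransGen (G.Linked (insert a (insert b C)) C) x b →
      (∃ q : G.Walk a b, q.Open C) ∨ ∃ q : G.Walk x b, q.Open C := by
    intro x hx
    induction hx using ReflTransGen.head_induction_on with
    | refl => exact .inr ⟨.nil b, Walk.open_nil b⟩
    | head h _ ih => exact ih.elim .inl fun ih => exists_open_of_linked h ih
  exact (key h).elim id id

/-- The augmentation criterion for m-separation. -/
theorem mSep_singleton_iff (hac : ∀ v, ¬ Relation.TransGen G.dir v v) (ha : a ∉ C) (hb : b ∉ C) :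
    G.MSep {a} {b} C ↔ ¬ ReflTransGen (G.Linked (insert a (insert b C)) C) a b := by
  constructor
  · intro h hr
    obtain ⟨p, hp⟩ := exists_open_of_chain hr
    obtain ⟨q, hq, hqo, _⟩ := Walk.exists_isPath hac p hp
    exact h a rfl b rfl q ⟨hq, hqo⟩
  · rintro h _ rfl _ rfl p ⟨_, hp⟩
    exact h (chain_of_open p ha hb hp)

end Chain

end MixedGraph

namespace MixedGraph

variable {V : Type*} {G H : MixedGraph V}

open Relation (ReflTransGen TransGen)

/-! ### Parametrizing sets and m-separation -/

theorem linked_iff [Finite V] (hac : ∀ v, ¬ TransGen G.dir v v) {W C : Set V} {x y : V} :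
    G.Linked W C x y ↔
      x ∉ C ∧ y ∉ C ∧ ∃ S ∈ G.parametrizingSets, x ∈ S ∧ y ∈ S ∧ S ⊆ G.an W := by
  rw [exists_parametrizingSet_iff hac, Linked]

theorem not_mSep_of_mem_parametrizingSets [Finite V] (hac : ∀ v, ¬ TransGen G.dir v v)
    {W C : Set V} (hW : W ∈ G.parametrizingSets) {a b : V} (ha : a ∈ W) (hb : b ∈ W) (haC : a ∉ C)
    (hbC : b ∉ C) (h : W ⊆ insert a (insert b C)) : ¬ G.MSep {a} {b} C := by
  rw [mSep_singleton_iff hac haC hbC, not_not]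
  exact .single ((linked_iff hac).2 ⟨haC, hbC, W, hW, ha, hb, h.trans (subset_an _)⟩)

/-- Take `b` barren in `W`, `a ∈ W` outside the blanket of `b`, and `C = an W \ {a, b}`. No other
vertex of `an W` is available to a chain, and a direct link would put `a` in the blanket of `b`. -/
theorem exists_mSep_of_notMem_parametrizingSets [Finite V] (hac : ∀ v, ¬ TransGen G.dir v v)
    {W : Set V} (hne : W.Nonempty) (hW : W ∉ G.parametrizingSets) :
    ∃ a ∈ W, ∃ b ∈ W, ∃ C : Set V, a ≠ b ∧ a ∉ C ∧ b ∉ C ∧ W ⊆ insert a (insert b C) ∧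
      G.MSep {a} {b} C := by
  obtain ⟨w, hw⟩ := hne
  obtain ⟨b, hb, -⟩ := subset_an_barren hac W hw
  obtain ⟨a, ha, hab⟩ := Set.not_subset.1
    (mt (mem_parametrizingSets_of_subset_blanket hac hb.1) hW)
  have hne : a ≠ b := by
    rintro rfl
    exact hab (self_mem_blanket _ _)
  have haC : a ∉ G.an W \ {a, b} := fun h => h.2 (by simp)
  have hbC : b ∉ G.an W \ {a, b} := fun h => h.2 (by simp)
  have hsub : G.an W ⊆ insert a (insert b (G.an W \ {a, b})) := fun x hx => by
    by_cases h : x ∈ ({a, b} : Set V)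
    · rcases h with rfl | rfl <;> simp
    · exact Or.inr (Or.inr ⟨hx, h⟩)
  refine ⟨a, ha, b, hb.1, G.an W \ {a, b}, hne, haC, hbC, (subset_an W).trans hsub, ?_⟩
  rw [mSep_singleton_iff hac haC hbC]
  have han : G.an (insert a (insert b (G.an W \ {a, b}))) = G.an W := by
    refine Set.Subset.antisymm (an_subset_an ?_) (an_mono ((subset_an W).trans hsub))
    exact Set.insert_subset (subset_an W ha) (Set.insert_subset (subset_an W hb.1) Set.sdiff_subset)
  intro hr
  have key : ∀ y, ReflTransGen (G.Linked (insert a (insert b (G.an W \ {a, b})))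
      (G.an W \ {a, b})) a y → y = a := by
    intro y hy
    induction hy with
    | refl => rfl
    | @tail u y _ h ih =>
      rw [ih] at h
      obtain ⟨_, hyC, z, hz, hxz, hyz⟩ := h
      rw [han] at hz hxz hyz
      by_contra hya
      have := blanket_subset hz hyz
      obtain rfl : y = b := by
        by_contra hyb
        exact hyC ⟨this, by simp [hya, hyb]⟩
      rw [← blanket_eq (mem_disIn_of_mem_barren hac hb hz hyz)] at hxz
      exact hab hxz
  exact hne (key b hr).symm

theorem MarkovEquivalent.symm (h : G.MarkovEquivalent H) : H.MarkovEquivalent G :=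
  fun A B C hA hB hAB hAC hBC => (h A B C hA hB hAB hAC hBC).symm

theorem MarkovEquivalent.mSep_singleton_iff (h : G.MarkovEquivalent H) {a b : V} {C : Set V}
    (hab : a ≠ b) (ha : a ∉ C) (hb : b ∉ C) : G.MSep {a} {b} C ↔ H.MSep {a} {b} C :=
  h _ _ _ (Set.singleton_nonempty a) (Set.singleton_nonempty b) (by simpa using hab)
    (by simpa using ha) (by simpa using hb)

theorem nonempty_of_mem_parametrizingSets {W : Set V} (h : W ∈ G.parametrizingSets) :
    W.Nonempty := by
  obtain ⟨B, A, ⟨_, v, ⟨w, hw, _⟩, _⟩, _, rfl⟩ := h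
  exact ⟨w, .inl hw⟩

theorem MarkovEquivalent.parametrizingSets_subset [Finite V] (hG : ∀ v, ¬ TransGen G.dir v v)
    (hH : ∀ v, ¬ TransGen H.dir v v) (h : G.MarkovEquivalent H) :
    G.parametrizingSets ⊆ H.parametrizingSets := by
  intro W hW
  by_contra hW'
  obtain ⟨a, ha, b, hb, C, hab, haC, hbC, hsub, hsep⟩ :=
    exists_mSep_of_notMem_parametrizingSets hH (nonempty_of_mem_parametrizingSets hW) hW'
  exact not_mSep_of_mem_parametrizingSets hG hW ha hb haC hbC hsub
    ((h.mSep_singleton_iff hab haC hbC).2 hsep)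

/-- By maximality, the parametrizing sets determine the adjacencies. -/
theorem IsMAG.pair_mem_parametrizingSets_iff [Finite V] (hG : G.IsMAG) {d e : V} (hne : d ≠ e) :
    {d, e} ∈ G.parametrizingSets ↔ G.Adj d e := by
  refine ⟨fun h => ?_, pair_mem_parametrizingSets hG.acyclic⟩
  by_contra hadj
  obtain ⟨C, hd, he, hsep⟩ := hG.maximal d e hne hadj
  refine not_mSep_of_mem_parametrizingSets hG.acyclic h (by simp) (by simp) hd he ?_ hsep
  intro x hx
  rcases hx with rfl | rfl <;> simp

/-! ### Distances along directed paths -/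

/-- Every set `T` has a distance function along directed paths. -/
theorem exists_dist (G : MixedGraph V) (T : Set V) : ∃ f : V → ℕ,
    (∀ v ∈ G.an T, v ∉ T → ∃ e ∈ G.an T, G.dir v e ∧ f v = f e + 1) ∧
      ∀ v e, G.dir v e → e ∈ G.an T → f v ≤ f e + 1 := by
  classical
  -- `R k v`: some directed walk of length `k` leads from `v` to `T`. Off `an T` the infimum takes
  -- the default value `0`, so the claims concern `an T`.
  let R : ℕ → V → Prop := fun k => Nat.rec (· ∈ T) (fun _ P v => ∃ e, G.dir v e ∧ P e) k
  have hR : ∀ v ∈ G.an T, ∃ k, R k v := by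
    rintro v ⟨t, ht, hr⟩
    induction hr using ReflTransGen.head_induction_on with
    | refl => exact ⟨0, ht⟩
    | head h _ ih => exact let ⟨k, hk⟩ := ih; ⟨k + 1, _, h, hk⟩
  have hR' : ∀ k v, R k v → v ∈ G.an T := by
    intro k
    induction k with
    | zero => exact fun v hv => subset_an T hv
    | succ k ih => exact fun v ⟨e, hd, he⟩ => mem_an_of_dir hd (ih e he)
  have hle : ∀ v e, G.dir v e → e ∈ G.an T → sInf {k | R k v} ≤ sInf {k | R k e} + 1 :=
    fun v e hd he => Nat.sInf_le ⟨e, hd, Nat.sInf_mem (s := {k | R k e}) (hR e he)⟩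
  refine ⟨fun v => sInf {k | R k v}, fun v hv hvT => ?_, hle⟩
  have hm : R (sInf {k | R k v}) v := Nat.sInf_mem (s := {k | R k v}) (hR v hv)
  rcases hk : sInf {k | R k v} with _ | k
  · rw [hk] at hm
    exact absurd hm hvT
  · rw [hk] at hm
    obtain ⟨e, hd, he⟩ := hm
    refine ⟨e, hR' k e he, hd, ?_⟩
    have h₁ := hle v e hd (hR' k e he)
    have h₂ : sInf {k | R k e} ≤ k := Nat.sInf_le he
    change sInf {k | R k v} = sInf {k | R k e} + 1
    omega

/-! ### Transfer of m-connection between graphs with the same parametrizing sets -/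

section Transfer

variable [Finite V] (hG : G.IsMAG) (hH : H.IsMAG)
  (hS : G.parametrizingSets = H.parametrizingSets)
include hG hH hS

/-- If `H` had an arrowhead at `v` on the edge to `e`, then `{u, v, e}` would be parametrizing in
`H`, hence in `G`; deleting `v`, a parent of `e` in `G`, would make `u` and `e` adjacent. -/
theorem dir_of_uncovered {u v e : V} (huv : G.dir u v) (hve : G.dir v e) (hue : ¬ G.Adj u e)
    (huv' : H.dir u v) : H.dir v e := by
  have huv_ne : u ≠ v := fun h => G.dir_irrefl v (h ▸ huv)
  have hve_ne : v ≠ e := fun h => G.dir_irrefl e (h ▸ hve)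
  have hue_ne : u ≠ e := by
    rintro rfl
    exact hG.acyclic u (.tail (.single huv) hve)
  have hadj : H.Adj v e := by
    rw [← hH.pair_mem_parametrizingSets_iff hve_ne, ← hS,
      hG.pair_mem_parametrizingSets_iff hve_ne]
    exact .inl hve
  rcases hadj with h | h
  · exact h
  exfalso
  have hmem : {e, u, v} ∈ H.parametrizingSets := by
    refine insert_mem_parametrizingSets hH.acyclic (d := v) (by simp) ?_
      (h.imp_right (H.bi_symm _ _))
    exact Set.insert_subset (mem_blanket_of_dir huv')
      (Set.singleton_subset_iff.2 (self_mem_blanket _ _))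
  rw [← hS] at hmem
  have := diff_singleton_mem_parametrizingSets hG.acyclic hmem (w := e) (by simp) (.single hve)
  have heq : ({e, u, v} : Set V) \ {v} = {u, e} := by
    ext x
    simp only [Set.mem_sdiff, Set.mem_insert_iff, Set.mem_singleton_iff]
    constructor
    · tauto
    · rintro (rfl | rfl)
      exacts [⟨by simp, huv_ne⟩, ⟨by simp, hve_ne.symm⟩]
  rw [heq, hG.pair_mem_parametrizingSets_iff hue_ne] at this
  exact hue this

/-- Along a shortest directed path of `G` to `T`, two vertices at distance two are nonadjacent (by
minimality, acyclicity and ancestrality), so `dir_of_uncovered` carries the orientation of each edge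
in `H` to the next. -/
theorem mem_an_of_dir_dir {T : Set V} {f : V → ℕ}
    (hf : ∀ v ∈ G.an T, v ∉ T → ∃ e ∈ G.an T, G.dir v e ∧ f v = f e + 1)
    (hf' : ∀ v e, G.dir v e → e ∈ G.an T → f v ≤ f e + 1) {u v : V} (hv : v ∈ G.an T)
    (huv : G.dir u v) (huv' : H.dir u v) (hfu : f u = f v + 1) : v ∈ H.an T := by
  induction hk : f v using Nat.strong_induction_on generalizing u v with
  | _ k ih =>
    by_cases hvT : v ∈ T
    · exact subset_an T hvT
    obtain ⟨e, he, hve, hfe⟩ := hf v hv hvT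
    have hue : ¬ G.Adj u e := by
      rintro (h | h | h)
      · have := hf' u e h he
        omega
      · exact hG.acyclic u (.tail (.tail (.single huv) hve) h)
      · have : u ∈ G.sib e ∩ G.an {e} := ⟨h, e, rfl, .head huv (.single hve)⟩
        rw [hG.ancestral] at this
        exact this
    have hve' := dir_of_uncovered hG hH hS huv hve hue huv'
    exact mem_an_of_dir hve' (ih (f e) (by omega) he hve hve' hfe rfl)

/-- Linked vertices of `G` lie in a parametrizing set whose other elements are ancestors of `T` in
both graphs. -/
theorem exists_parametrizingSet_of_linked {T : Set V} {x y : V}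
    (h : ∃ S ∈ G.parametrizingSets, x ∈ S ∧ y ∈ S ∧ S ⊆ G.an T) :
    ∃ S ∈ G.parametrizingSets, x ∈ S ∧ y ∈ S ∧ S ⊆ G.an T ∧
      ∀ d ∈ S, d ≠ x → d ≠ y → d ∈ H.an T := by
  classical
  have := Fintype.ofFinite V
  obtain ⟨f, hf, hf'⟩ := exists_dist G T
  -- The `+ 1` makes every deletion lower the weight; exchanging a vertex for one closer to `T`
  -- lowers it as well.
  let weight : Set V → ℕ := fun W => ∑ v, if v ∈ W then f v + 1 else 0
  obtain ⟨W, ⟨hW, hx, hy, hWT⟩, hmin⟩ := (measure weight).wf.has_min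
    {S | S ∈ G.parametrizingSets ∧ x ∈ S ∧ y ∈ S ∧ S ⊆ G.an T} h
  refine ⟨W, hW, hx, hy, hWT, fun d hd hdx hdy => ?_⟩
  by_cases hdT : d ∈ T
  · exact subset_an T hdT
  have hH' : W ⊆ H.blanket (H.an W) d := by
    refine (exists_transGen_or_subset_blanket hH.acyclic (hS ▸ hW) hd).resolve_left ?_
    rintro ⟨w, hw, hdw⟩
    refine hmin (W \ {d}) ⟨?_, ⟨hx, hdx.symm⟩, ⟨hy, hdy.symm⟩, Set.sdiff_subset.trans hWT⟩ ?_
    · rw [hS] at hW ⊢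
      exact diff_singleton_mem_parametrizingSets hH.acyclic hW hw hdw
    · change weight _ < weight _
      refine Finset.sum_lt_sum (fun v _ => ?_) ⟨d, Finset.mem_univ d, ?_⟩
      · by_cases hv : v ∈ W <;> by_cases hvd : v = d <;> simp [hv, hvd]
      · simp [hd]
  obtain ⟨e, he, hde, hfd⟩ := hf d (hWT hd) hdT
  have hde_ne : d ≠ e := fun h => G.dir_irrefl e (h ▸ hde)
  have hadj : H.Adj d e := by
    rw [← hH.pair_mem_parametrizingSets_iff hde_ne, ← hS,
      hG.pair_mem_parametrizingSets_iff hde_ne]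
    exact .inl hde
  have hde' : H.dir d e := by
    rcases hadj with h | h
    · exact h
    exfalso
    -- Otherwise `e` could be added, by its arrowhead at `d` in `H`, and `d` then deleted, as a
    -- parent of `e` in `G`.
    have hins := insert_mem_parametrizingSets hH.acyclic hd hH' (h.imp_right (H.bi_symm _ _))
    rw [← hS] at hins
    refine hmin (insert e W \ {d})
      ⟨diff_singleton_mem_parametrizingSets hG.acyclic hins (Set.mem_insert e W) (.single hde),
        ⟨.inr hx, hdx.symm⟩, ⟨.inr hy, hdy.symm⟩,
        Set.sdiff_subset.trans (Set.insert_subset he hWT)⟩ ?_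
    -- An inequality, since `e` may already belong to `W`.
    have hle : weight (insert e W \ {d}) + ∑ v, (if v = d then f v + 1 else 0) ≤
        weight W + ∑ v, (if v = e then f v + 1 else 0) := by
      rw [← Finset.sum_add_distrib, ← Finset.sum_add_distrib]
      refine Finset.sum_le_sum fun v _ => ?_
      by_cases hvd : v = d
      · subst hvd
        simp [hd]
      · by_cases hve : v = e
        · subst hve
          simp [hvd]
        · by_cases hv : v ∈ W <;> simp [hvd, hve, hv]
    simp only [Finset.sum_ite_eq', Finset.mem_univ, if_true] at hle
    change weight _ < weight _
    omega
  exact mem_an_of_dir hde' (mem_an_of_dir_dir hG hH hS hf hf' he hde hde' hfd)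

end Transfer

/-- A shortest chain of steps between two points linked by a relation. -/
theorem exists_shortest_chain {α : Type*} {r : α → α → Prop} {a b : α} (h : ReflTransGen r a b) :
    ∃ (n : ℕ) (x : ℕ → α), x 0 = a ∧ x n = b ∧ (∀ i < n, r (x i) (x (i + 1))) ∧
      ∀ i, i + 2 ≤ n → ¬ r (x i) (x (i + 2)) := by
  classical
  have hex : ∃ n, ∃ x : ℕ → α, x 0 = a ∧ x n = b ∧ ∀ i < n, r (x i) (x (i + 1)) := by
    induction h with
    | refl => exact ⟨0, fun _ => a, rfl, rfl, fun i hi => absurd hi (Nat.not_lt_zero i)⟩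
    | @tail b c _ hbc ih =>
      obtain ⟨n, x, h0, hn, hx⟩ := ih
      refine ⟨n + 1, fun i => if i ≤ n then x i else c, by simp [h0], by simp, fun i hi => ?_⟩
      rcases Nat.lt_succ_iff_lt_or_eq.1 hi with hi | rfl
      · simpa [hi.le, hi] using hx i hi
      · simpa [hn] using hbc
  obtain ⟨x, h0, hn, hx⟩ := Nat.find_spec hex
  refine ⟨Nat.find hex, x, h0, hn, hx, fun i hi hr => ?_⟩
  refine Nat.find_min hex (m := Nat.find hex - 1) (by omega)
    ⟨fun j => if j ≤ i then x j else x (j + 1), by simp [h0], ?_, fun j hj => ?_⟩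
  · have : ¬ Nat.find hex - 1 ≤ i := by omega
    simp only [this, if_false]
    rwa [Nat.sub_add_cancel (by omega)]
  · rcases lt_trichotomy j i with h | rfl | h
    · simpa [h.le, Nat.succ_le_of_lt h] using hx j (by omega)
    · simpa using hr
    · have h₁ : ¬ j ≤ i := by omega
      have h₂ : ¬ j + 1 ≤ i := by omega
      simpa [h₁, h₂] using hx (j + 1) (by omega)

/-- If an interior chain vertex has a proper `H`-descendant in one of its two neighbouring sets,
induction along descendants applies. If not, both sets lie in its `H`-blanket, so their union is
parametrizing and gives a shortcut in `G`. -/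
theorem chain_of_parametrizingSets_eq [Finite V] (hG : G.IsMAG) (hH : H.IsMAG)
    (hS : G.parametrizingSets = H.parametrizingSets) {T C : Set V} {a b : V} (haT : a ∈ T)
    (hbT : b ∈ T) (h : ReflTransGen (G.Linked T C) a b) : ReflTransGen (H.Linked T C) a b := by
  obtain ⟨n, x, h0, hn, hx, hmin⟩ := exists_shortest_chain h
  have hex : ∀ i : ℕ, ∃ S, i < n → S ∈ G.parametrizingSets ∧ x i ∈ S ∧ x (i + 1) ∈ S ∧
      S ⊆ G.an T ∧ ∀ d ∈ S, d ≠ x i → d ≠ x (i + 1) → d ∈ H.an T := by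
    intro i
    by_cases hi : i < n
    · obtain ⟨S, h⟩ := exists_parametrizingSet_of_linked hG hH hS
        ((linked_iff hG.acyclic).1 (hx i hi)).2.2
      exact ⟨S, fun _ => h⟩
    · exact ⟨∅, fun h => absurd h hi⟩
  choose S hSi using hex
  -- Quantified over all positions, since the descendant found may be another vertex of the chain.
  have hmem : ∀ v, ∀ i ≤ n, x i = v → v ∈ H.an T := by
    intro v
    induction v using (wellFounded_descendants hH.acyclic).induction with
    | _ v ih =>
      rintro i hi rfl
      have step : ∀ j < n, (∃ w ∈ S j, TransGen H.dir (x i) w) → x i ∈ H.an T := by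
        rintro j hj ⟨w, hw, ht⟩
        refine mem_an_of_reach ht.to_reflTransGen ?_
        by_cases h₁ : w = x j
        · exact ih w ht j hj.le h₁.symm
        by_cases h₂ : w = x (j + 1)
        · exact ih w ht (j + 1) hj h₂.symm
        exact (hSi j hj).2.2.2.2 w hw h₁ h₂
      rcases i with _ | i
      · rw [h0]
        exact subset_an T haT
      rcases hi.eq_or_lt with hi' | hi'
      · rw [hi', hn]
        exact subset_an T hbT
      obtain ⟨hS₁, hx₁, hx₁', hT₁, _⟩ := hSi i hi
      obtain ⟨hS₂, hx₂, hx₂', hT₂, _⟩ := hSi (i + 1) hi'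
      rcases exists_transGen_or_subset_blanket hH.acyclic (hS ▸ hS₁) hx₁' with h₁ | h₁
      · exact step i hi h₁
      rcases exists_transGen_or_subset_blanket hH.acyclic (hS ▸ hS₂) hx₂ with h₂ | h₂
      · exact step (i + 1) hi' h₂
      exfalso
      refine hmin i hi' ((linked_iff hG.acyclic).2 ⟨(hx i hi).1, (hx (i + 1) hi').2.1,
        S i ∪ S (i + 1), ?_, .inl hx₁, .inr hx₂', Set.union_subset hT₁ hT₂⟩)
      rw [hS]
      exact union_mem_parametrizingSets hH.acyclic hx₁' h₁ h₂
  have hlink : ∀ i < n, H.Linked T C (x i) (x (i + 1)) := by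
    intro i hi
    obtain ⟨hS₁, hx₁, hx₁', _, hd⟩ := hSi i hi
    refine (linked_iff hH.acyclic).2 ⟨(hx i hi).1, (hx i hi).2.1, S i, hS ▸ hS₁, hx₁, hx₁', ?_⟩
    intro d hdS
    by_cases h₁ : d = x i
    · exact hmem d i hi.le h₁.symm
    by_cases h₂ : d = x (i + 1)
    · exact hmem d (i + 1) hi h₂.symm
    exact hd d hdS h₁ h₂
  have : ∀ i ≤ n, ReflTransGen (H.Linked T C) a (x i) := by
    intro i
    induction i with
    | zero => exact fun _ => h0 ▸ .refl
    | succ i ih => exact fun hi => (ih (Nat.le_of_succ_le hi)).tail (hlink i hi)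
  exact hn ▸ this n le_rfl

/-- Markov equivalence of maximal ancestral graphs is equality of the parametrizing sets. -/
theorem markovEquivalent_iff_parametrizingSets_eq [Finite V] (hG : G.IsMAG) (hH : H.IsMAG) :
    G.MarkovEquivalent H ↔ G.parametrizingSets = H.parametrizingSets := by
  constructor
  · exact fun h => Set.Subset.antisymm (h.parametrizingSets_subset hG.acyclic hH.acyclic)
      (h.symm.parametrizingSets_subset hH.acyclic hG.acyclic)
  · intro hS A B C _ _ _ hAC hBC
    have key : ∀ a ∈ A, ∀ b ∈ B, (G.MSep {a} {b} C ↔ H.MSep {a} {b} C) := by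
      intro a ha b hb
      have haC := Set.disjoint_left.1 hAC ha
      have hbC := Set.disjoint_left.1 hBC hb
      rw [MixedGraph.mSep_singleton_iff hG.acyclic haC hbC,
        MixedGraph.mSep_singleton_iff hH.acyclic haC hbC, not_iff_not]
      exact ⟨chain_of_parametrizingSets_eq hG hH hS (by simp) (by simp),
        chain_of_parametrizingSets_eq hH hG hS.symm (by simp) (by simp)⟩
    constructor
    · exact fun h a ha b hb => (key a ha b hb).1
        (fun _ h₁ _ h₂ => by rw [h₁, h₂]; exact h a ha b hb) a rfl b rfl
    · exact fun h a ha b hb => (key a ha b hb).2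
        (fun _ h₁ _ h₂ => by rw [h₁, h₂]; exact h a ha b hb) a rfl b rfl

/-! ### Möbius inversion -/

/-- By induction from larger sets to smaller ones, only the term `A = B` survives. -/
theorem eq_zero_of_alternating_superset_sum_eq_zero [Fintype V] [DecidableEq V]
    {k : Finset V → ℤ} (h : ∀ B, ∑ A : Finset V with B ⊆ A, (-1) ^ (A \ B).card * k A = 0)
    (B : Finset V) : k B = 0 := by
  induction B using WellFounded.induction (wellFounded_gt (α := Finset V)) with
  | _ B ih =>
    have := h B
    rw [Finset.sum_eq_single B] at this
    · simpa using this
    · intro A hA hne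
      rw [ih A (lt_of_le_of_ne (Finset.mem_filter.1 hA).2 hne.symm), mul_zero]
    · exact fun hB => absurd (Finset.mem_filter.2 ⟨Finset.mem_univ B, subset_rfl⟩) hB

theorem standardImset_eq_iff [Fintype V] [DecidableEq V] :
    G.standardImset = H.standardImset ↔ G.characteristicImset = H.characteristicImset := by
  constructor
  · intro h
    funext B
    rw [← sub_eq_zero]
    refine eq_zero_of_alternating_superset_sum_eq_zero
      (k := fun B => G.characteristicImset B - H.characteristicImset B) (fun B => ?_) B
    have := congrFun h B
    rw [standardImset, standardImset, eq_comm, ← sub_eq_zero, ← Finset.sum_sub_distrib] at this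
    rw [← this]
    exact Finset.sum_congr rfl fun A _ => by ring
  · intro h
    funext B
    rw [standardImset, standardImset, h]

/-- The conventional value at `∅` loses nothing, because parametrizing sets are nonempty. -/
theorem characteristicImset_eq_iff [Finite V] :
    G.characteristicImset = H.characteristicImset ↔
      G.parametrizingSets = H.parametrizingSets := by
  classical
  constructor
  · have key : ∀ {G H : MixedGraph V}, G.characteristicImset = H.characteristicImset →
        G.parametrizingSets ⊆ H.parametrizingSets := by
      intro G H h W hW
      have hne := nonempty_of_mem_parametrizingSets hW
      obtain ⟨S, rfl⟩ := W.toFinite.exists_finset_coe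
      have := congrFun h S
      have hS : S ≠ ∅ := (Finset.coe_nonempty.1 hne).ne_empty
      by_contra hW'
      simp [characteristicImset, hW, hW', hS] at this
    exact fun h => Set.Subset.antisymm (key h) (key h.symm)
  · intro h
    funext S
    rw [characteristicImset, characteristicImset, h]

end MixedGraph

theorem mainTheorem8 {V : Type*} [Fintype V] [DecidableEq V] (G H : MixedGraph V)
    (hG : G.IsMAG) (hH : H.IsMAG) :
    G.MarkovEquivalent H ↔ G.standardImset = H.standardImset := by
  rw [MixedGraph.markovEquivalent_iff_parametrizingSets_eq hG hH, MixedGraph.standardImset_eq_iff,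
    MixedGraph.characteristicImset_eq_iff]
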